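/- Let $p(x)=x^3+a_2x^2+a_1x+a_0\in\mathbb{Z}[x]$ be irreducible, with $a_2^2-a_1$ even and $a_1a_2-a_0$ odd. For real $X$, let $B_p(X)$ be the set of integers $n$ with $1\le n\le X$ such that $p(n)=y^2+z^2$ for some $y,z\in\mathbb{Z}$. Then $$\#B_p(X)\gg X^{1/3-o(1)}\qquad (X\to\infty),$$ that is, there are a function $\delta$ with $\delta(X)\to 0$ as $X\to\infty$ and constants $c>0$ and $X_0$ (all depending on $p$) such that $\#B_p(X)\ge c\,X^{1/3-\delta(X)}$ for all $X\ge X_0$. In particular, if $h$ is an odd integer that is not the cube of an integer, then $$\#\{n\in\mathbb{Z}:\ 1\le n\le X,\ n^3+h=y^2+z^2\text{ for some }y,z\in\mathbb{Z}\}\gg X^{1/3-o(1)}\qquad (X\to\infty)$$ in the same sense. -/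

import Mathlib

/-- The set of integers `n` with `1 ≤ n ≤ X` such that `p(n)` is a sum of two integer squares
(zero is allowed as one of the squares). -/
def sumTwoSquaresValues (p : Polynomial ℤ) (X : ℝ) : Set ℤ :=
  {n : ℤ | 1 ≤ n ∧ (n : ℝ) ≤ X ∧ ∃ y z : ℤ, p.eval n = y ^ 2 + z ^ 2}

/-- `f(X) ≫ X ^ (a - o(1))` as `X → ∞`: for some function `δ` with `δ(X) → 0` as `X → ∞`,
`X ^ (a - δ(X))` is at most a constant times `f(X)` for all sufficiently large `X`. -/
def LowerBoundPowSubLittleO (f : ℝ → ℝ) (a : ℝ) : Prop :=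
  ∃ δ : ℝ → ℝ, Filter.Tendsto δ Filter.atTop (nhds 0) ∧
    ∃ c : ℝ, 0 < c ∧ ∀ᶠ X : ℝ in Filter.atTop, c * X ^ (a - δ X) ≤ f X

/-! Let `θ` be a root of the cubic `p` and work in `ℤ[i][θ]`, with conjugation acting on the
Gaussian coefficients. If `γ γ̄ = n - θ`, then taking norms gives `p(n) = N(γ) · star N(γ)`, a sum
of two squares. So it is enough to produce many such `γ` and to bound how often one `n` recurs.

Write `γ = x + (v + i s) θ + (w + i t) θ²`. The vanishing of the `θ²` coefficient of `γ γ̄` and the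
value `-1` of its `θ` coefficient are two real linear equations for `x` with determinant `v t - w
s`. When this is `1`, they are solvable over `ℤ` up to a factor `2`, which parity removes
(`cubicMul_conj_of_det_eq_one`, `exists_half_eq`). Take `w = 2 u` with `u ≍ H`, `t < w` coprime to
`w`, and complete `(w, t)` to a matrix with `v ≍ H` (`exists_odd_row`). Then `x ≍ H³` and `n ≍ H⁶`,
and there are `H^(2 - o(1))` pairs. With `X ≍ H⁶` this is `X^(1/3 - o(1))`.

For the multiplicity, fix `n`. Modulo `n - θ` the ring becomes `ℤ[i]/(p(n))`, so a factor `γ` of `n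
- θ` is determined up to divisibility by its norm: if `N(γ) ∣ N(Γ)`, then `γ ∣ Γ`
(`CubicMul.exists_cubicMul_of_norm_dvd`). As `x` dominates both factors, the quotient is close to
the constant `X / x`, hence is a Gaussian integer (`CubicMul.exists_coeff_eq_zero`). Determinant one
makes it a unit, and `0 < t < w` makes that unit trivial (`eq_of_eq_mul_of_wedge`). Thus `n` recurs
at most as often as `p(n)` has divisors in `ℤ[i]` up to units, which is `H^(o(1))` by the divisor
bound. -/

/-! ### Divisor bounds in `ℕ` and `ℤ[i]`. -/

theorem add_one_le_mul_rpow_pow {ε : ℝ} (hε : 0 < ε) {N : ℕ} (hN : 2 ≤ N) (k : ℕ) :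
    (k : ℝ) + 1 ≤ (1 + 1 / (ε * Real.log 2)) * ((N : ℝ) ^ k) ^ ε := by
  have hl : 0 < Real.log 2 := Real.log_pos (by norm_num)
  have hel : 0 < ε * Real.log 2 := by positivity
  have hN' : (2 : ℝ) ≤ N := by exact_mod_cast hN
  have h1 : (2 : ℝ) ^ k ≤ (N : ℝ) ^ k := by gcongr
  have h2 : 1 + k * (ε * Real.log 2) ≤ ((N : ℝ) ^ k) ^ ε := by
    calc 1 + k * (ε * Real.log 2) ≤ Real.exp (k * (ε * Real.log 2)) := by
          rw [add_comm]; exact Real.add_one_le_exp _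
      _ = ((2 : ℝ) ^ k) ^ ε := by
          rw [Real.rpow_def_of_pos (by positivity), Real.log_pow]; ring_nf
      _ ≤ _ := by gcongr
  have h3 : 1 / (ε * Real.log 2) * (k * (ε * Real.log 2)) = k := by field_simp
  have h4 : 0 < 1 / (ε * Real.log 2) := by positivity
  have hk : (0 : ℝ) ≤ k * (ε * Real.log 2) := by positivity
  nlinarith

theorem add_one_le_rpow_pow {ε : ℝ} {N : ℕ} (hN : 2 ≤ (N : ℝ) ^ ε) (k : ℕ) :
    (k : ℝ) + 1 ≤ ((N : ℝ) ^ k) ^ ε := by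
  have h : ((N : ℝ) ^ k) ^ ε = ((N : ℝ) ^ ε) ^ k := by
    rw [← Real.rpow_natCast, ← Real.rpow_mul (by positivity), mul_comm,
      Real.rpow_mul (by positivity), Real.rpow_natCast]
  rw [h]
  calc (k : ℝ) + 1 ≤ (2 : ℝ) ^ k := by exact_mod_cast Nat.lt_two_pow_self
    _ ≤ _ := by gcongr

/-- The divisor bound, in multiset form: a multiset of elements of size at least two has few
submultisets, compared with the product of the sizes of its elements. -/
theorem exists_card_Iic_le_mul_rpow {α : Type*} [DecidableEq α] (N : α → ℕ)
    (hN : ∀ B : ℕ, {x | N x < B}.Finite) {ε : ℝ} (hε : 0 < ε) :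
    ∃ C : ℝ, 0 < C ∧ ∀ s : Multiset α, (∀ x ∈ s, 2 ≤ N x) →
      ((Finset.Iic s).card : ℝ) ≤ C * (((s.map N).prod : ℕ) : ℝ) ^ ε := by
  set K : ℝ := 1 + 1 / (ε * Real.log 2) with hK
  have hK1 : 1 ≤ K := by
    have : 0 < Real.log 2 := Real.log_pos (by norm_num)
    rw [hK]; simp; positivity
  -- If `N x ≥ 2^(1/ε)`, then `k + 1 ≤ 2^k ≤ (N x)^(k ε)` without loss. Each of the finitely many
  -- smaller elements costs one factor `K`.
  obtain ⟨B, hB⟩ := exists_nat_ge ((2 : ℝ) ^ (1 / ε))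
  refine ⟨K ^ (hN B).toFinset.card, by positivity, fun s hs ↦ ?_⟩
  rw [Multiset.card_Iic, Finset.prod_multiset_map_count]
  push_cast
  rw [← Real.finsetProd_rpow _ _ (fun _ _ ↦ by positivity)]
  calc ∏ x ∈ s.toFinset, ((s.count x : ℝ) + 1)
      ≤ ∏ x ∈ s.toFinset, ((if N x < B then K else 1) * ((N x : ℝ) ^ s.count x) ^ ε) := by
        refine Finset.prod_le_prod (fun _ _ ↦ by positivity) fun x hx ↦ ?_
        split_ifs with h
        · exact add_one_le_mul_rpow_pow hε (hs x (Multiset.mem_toFinset.1 hx)) _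
        · rw [one_mul]
          apply add_one_le_rpow_pow
          have h1 : (2 : ℝ) ^ (1 / ε) ≤ N x := hB.trans (by exact_mod_cast not_lt.1 h)
          calc (2 : ℝ) = ((2 : ℝ) ^ (1 / ε)) ^ ε := by
                rw [← Real.rpow_mul (by norm_num), one_div_mul_cancel hε.ne', Real.rpow_one]
            _ ≤ _ := by gcongr
    _ = (∏ x ∈ s.toFinset, if N x < B then K else 1) *
          ∏ x ∈ s.toFinset, ((N x : ℝ) ^ s.count x) ^ ε := Finset.prod_mul_distrib
    _ ≤ _ := by
        gcongr
        rw [← Finset.prod_filter, Finset.prod_const]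
        refine pow_le_pow_right₀ hK1 (Finset.card_le_card fun x hx ↦ ?_)
        simpa using (Finset.mem_filter.1 hx).2

theorem Nat.exists_card_divisors_le_mul_rpow {ε : ℝ} (hε : 0 < ε) :
    ∃ C : ℝ, 0 < C ∧ ∀ n : ℕ, n ≠ 0 → (n.divisors.card : ℝ) ≤ C * (n : ℝ) ^ ε := by
  obtain ⟨C, hC, h⟩ := exists_card_Iic_le_mul_rpow (id : ℕ → ℕ) (fun B ↦ Set.finite_lt_nat B) hε
  refine ⟨C, hC, fun n hn ↦ ?_⟩
  have h1 := h (UniqueFactorizationMonoid.normalizedFactors n) fun x hx ↦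
    (UniqueFactorizationMonoid.prime_of_normalized_factor x hx).nat_prime.two_le
  have h2 : (UniqueFactorizationMonoid.normalizedFactors n).prod = n :=
    associated_iff_eq.1 (UniqueFactorizationMonoid.prod_normalizedFactors hn)
  rw [Multiset.map_id, h2] at h1
  refine le_trans ?_ h1
  norm_cast
  refine Finset.card_le_card_of_injOn UniqueFactorizationMonoid.normalizedFactors ?_ ?_
  · intro d hd
    have hd' := Nat.dvd_of_mem_divisors hd
    simpa using (UniqueFactorizationMonoid.dvd_iff_normalizedFactors_le_normalizedFactors
      (ne_zero_of_dvd_ne_zero hn hd') hn).1 hd'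
  · intro d hd e he hde
    exact associated_iff_eq.1 <|
      (UniqueFactorizationMonoid.associated_iff_normalizedFactors_eq_normalizedFactors
      (ne_zero_of_dvd_ne_zero hn (Nat.dvd_of_mem_divisors hd))
      (ne_zero_of_dvd_ne_zero hn (Nat.dvd_of_mem_divisors he))).2 hde

/-- In `n = ∑ φ(d)` over `d ∣ n`, every term is at most `φ(n)`. With the divisor bound this gives
`φ(n) ≫ n^(1 - ε)`. -/
theorem Nat.le_card_divisors_mul_totient {n : ℕ} (hn : n ≠ 0) :
    n ≤ n.divisors.card * n.totient := by
  conv_lhs => rw [← Nat.sum_totient n]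
  rw [← smul_eq_mul]
  exact Finset.sum_le_card_nsmul _ _ _ fun d hd ↦ Nat.le_of_dvd
    (Nat.totient_pos.2 (Nat.pos_of_ne_zero hn)) (Nat.totient_dvd_of_dvd (Nat.dvd_of_mem_divisors hd))

/-- Choosing an associate in each class makes `normalizedFactors` available: divisors up to units
become submultisets of a multiset of primes. -/
noncomputable instance GaussianInt.strongNormalizationMonoid :
    StrongNormalizationMonoid GaussianInt :=
  UniqueFactorizationMonoid.strongNormalizationMonoid

theorem GaussianInt.finite_norm_natAbs_lt (B : ℕ) :
    {x : GaussianInt | x.norm.natAbs < B}.Finite := by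
  refine Set.Finite.of_finite_image (f := fun x : GaussianInt ↦ (x.re, x.im))
    (((Set.finite_Icc (-(B : ℤ)) B).prod (Set.finite_Icc (-(B : ℤ)) B)).subset ?_) ?_
  · rintro _ ⟨x, hx, rfl⟩
    have hx' : x.norm < B := by
      rw [← GaussianInt.abs_natCast_norm]; exact_mod_cast hx
    rw [Zsqrtd.norm_def] at hx'
    have hre : x.re ^ 2 ≤ B ^ 2 := by nlinarith [mul_self_nonneg x.im, mul_self_nonneg x.re]
    have him : x.im ^ 2 ≤ B ^ 2 := by nlinarith [mul_self_nonneg x.im, mul_self_nonneg x.re]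
    exact ⟨abs_le.1 (abs_le_of_sq_le_sq hre (by positivity)),
      abs_le.1 (abs_le_of_sq_le_sq him (by positivity))⟩
  · intro x _ y _ h
    exact Zsqrtd.ext (congrArg Prod.fst h) (congrArg Prod.snd h)

theorem GaussianInt.two_le_norm_natAbs_of_prime {x : GaussianInt} (hx : Prime x) :
    2 ≤ x.norm.natAbs := by
  have h0 : x.norm.natAbs ≠ 0 := by
    rw [Int.natAbs_ne_zero, Ne, GaussianInt.norm_eq_zero]; exact hx.ne_zero
  have h1 : x.norm.natAbs ≠ 1 := by
    rw [Ne, Zsqrtd.norm_eq_one_iff]; exact hx.not_isUnit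
  omega

theorem GaussianInt.exists_card_Iic_normalizedFactors_le_mul_rpow {ε : ℝ} (hε : 0 < ε) :
    ∃ C : ℝ, 0 < C ∧ ∀ x : GaussianInt, x ≠ 0 →
      ((Finset.Iic (UniqueFactorizationMonoid.normalizedFactors x)).card : ℝ) ≤
        C * (x.norm : ℝ) ^ ε := by
  obtain ⟨C, hC, h⟩ := exists_card_Iic_le_mul_rpow (fun x : GaussianInt ↦ x.norm.natAbs)
    GaussianInt.finite_norm_natAbs_lt hε
  refine ⟨C, hC, fun x hx ↦ ?_⟩
  have h1 := h (UniqueFactorizationMonoid.normalizedFactors x) fun y hy ↦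
    GaussianInt.two_le_norm_natAbs_of_prime
      (UniqueFactorizationMonoid.prime_of_normalized_factor y hy)
  have h2 : (((UniqueFactorizationMonoid.normalizedFactors x).map
      fun y : GaussianInt ↦ y.norm.natAbs).prod) = x.norm.natAbs := by
    have h3 := UniqueFactorizationMonoid.prod_normalizedFactors hx
    have h4 := (h3.map (Zsqrtd.normMonoidHom (d := -1))).map Int.natAbsHom
    rw [associated_iff_eq] at h4
    rw [map_multiset_prod, map_multiset_prod, Multiset.map_map] at h4
    exact h4
  rw [h2] at h1
  convert h1 using 3
  rw [← Int.cast_natCast, GaussianInt.abs_natCast_norm]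

/-! ### The ring `S[θ]` in coordinates, and factors of `n - θ`. -/

/-- The norm of `x + y θ + z θ²` where `θ³ + a₂ θ² + a₁ θ + a₀ = 0`. -/
def cubicNorm {S : Type*} [CommRing S] (a₂ a₁ a₀ x y z : S) : S :=
  x * ((x - a₁ * z) * (x - a₁ * z - a₂ * (y - a₂ * z))
      - (-a₀ * z - a₁ * (y - a₂ * z)) * (y - a₂ * z))
    + (-a₀ * z) * -(y * (x - a₁ * z - a₂ * (y - a₂ * z)) - (-a₀ * z - a₁ * (y - a₂ * z)) * z)
    + (-a₀ * (y - a₂ * z)) * (y * (y - a₂ * z) - (x - a₁ * z) * z)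

theorem cubicNorm_map {S T : Type*} [CommRing S] [CommRing T] (f : S →+* T)
    (a₂ a₁ a₀ x y z : S) : f (cubicNorm a₂ a₁ a₀ x y z) =
      cubicNorm (f a₂) (f a₁) (f a₀) (f x) (f y) (f z) := by
  simp [cubicNorm]

section
variable {S : Type*} [CommRing S]

/-- The relation `(x + y θ + z θ²) (x' + y' θ + z' θ²) = r₀ + r₁ θ + r₂ θ²` in coordinates, where
`θ³ + a₂ θ² + a₁ θ + a₀ = 0`. -/
structure CubicMul (a₂ a₁ a₀ x y z x' y' z' r₀ r₁ r₂ : S) : Prop where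
  coeff_zero : x * x' - a₀ * (y * z' + z * y') + a₀ * a₂ * (z * z') = r₀
  coeff_one : x * y' + y * x' - a₁ * (y * z' + z * y') + (a₁ * a₂ - a₀) * (z * z') = r₁
  coeff_two : x * z' + y * y' + z * x' - a₂ * (y * z' + z * y') + (a₂ ^ 2 - a₁) * (z * z') = r₂

theorem CubicMul.cubicNorm_mul {a₂ a₁ a₀ x y z x' y' z' r₀ r₁ r₂ : S}
    (h : CubicMul a₂ a₁ a₀ x y z x' y' z' r₀ r₁ r₂) :
    cubicNorm a₂ a₁ a₀ x y z * cubicNorm a₂ a₁ a₀ x' y' z' = cubicNorm a₂ a₁ a₀ r₀ r₁ r₂ := by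
  rw [← h.coeff_zero, ← h.coeff_one, ← h.coeff_two]
  simp only [cubicNorm]
  ring

theorem cubicNorm_sub_root (a₂ a₁ a₀ n : S) :
    cubicNorm a₂ a₁ a₀ n (-1) 0 = n ^ 3 + a₂ * n ^ 2 + a₁ * n + a₀ := by
  simp only [cubicNorm]
  ring

open Polynomial in
/-- The polynomial `X³ + a₂ X² + a₁ X + a₀`. -/
noncomputable def monicCubic (a₂ a₁ a₀ : S) : S[X] := X ^ 3 + C a₂ * X ^ 2 + C a₁ * X + C a₀

open Polynomial in
theorem monicCubic_monic (a₂ a₁ a₀ : S) : (monicCubic a₂ a₁ a₀).Monic := by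
  unfold monicCubic; monicity!

open Polynomial in
theorem monicCubic_degree [Nontrivial S] (a₂ a₁ a₀ : S) : (monicCubic a₂ a₁ a₀).degree = 3 := by
  unfold monicCubic; compute_degree!

/-- The element `x + y θ + z θ²` of `S[X] / (X³ + a₂ X² + a₁ X + a₀)`. -/
noncomputable def cubicElt (a₂ a₁ a₀ x y z : S) : AdjoinRoot (monicCubic a₂ a₁ a₀) :=
  AdjoinRoot.of _ x + AdjoinRoot.of _ y * AdjoinRoot.root _
    + AdjoinRoot.of _ z * AdjoinRoot.root _ ^ 2

open Polynomial in
theorem exists_eq_cubicElt [Nontrivial S] {a₂ a₁ a₀ : S} (r : AdjoinRoot (monicCubic a₂ a₁ a₀)) :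
    ∃ x y z, r = cubicElt a₂ a₁ a₀ x y z := by
  obtain ⟨g, rfl⟩ := AdjoinRoot.mk_surjective r
  have hm := monicCubic_monic a₂ a₁ a₀
  have h1 : AdjoinRoot.mk (monicCubic a₂ a₁ a₀) g
      = AdjoinRoot.mk _ (g %ₘ monicCubic a₂ a₁ a₀) := by
    rw [eq_comm, AdjoinRoot.mk_eq_mk]
    exact dvd_modByMonic_sub _ _
  have h2 : (g %ₘ monicCubic a₂ a₁ a₀).degree ≤ 2 := by
    have := degree_modByMonic_lt g hm
    rw [monicCubic_degree] at this
    exact Order.le_of_lt_succ this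
  rw [h1, eq_quadratic_of_degree_le_two h2]
  refine ⟨(g %ₘ monicCubic a₂ a₁ a₀).coeff 0, (g %ₘ monicCubic a₂ a₁ a₀).coeff 1,
    (g %ₘ monicCubic a₂ a₁ a₀).coeff 2, ?_⟩
  simp only [map_add, map_mul, map_pow, AdjoinRoot.mk_C, AdjoinRoot.mk_X, cubicElt]
  ring

open Polynomial in
theorem cubicElt_injective [Nontrivial S] {a₂ a₁ a₀ x y z x' y' z' : S}
    (h : cubicElt a₂ a₁ a₀ x y z = cubicElt a₂ a₁ a₀ x' y' z') : x = x' ∧ y = y' ∧ z = z' := by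
  have key : ∀ u v w : S, cubicElt a₂ a₁ a₀ u v w
      = AdjoinRoot.mk _ (C w * X ^ 2 + C v * X + C u) := by
    intro u v w
    simp only [map_add, map_mul, map_pow, AdjoinRoot.mk_C, AdjoinRoot.mk_X, cubicElt]
    ring
  rw [key, key, AdjoinRoot.mk_eq_mk] at h
  have h2 : C z * X ^ 2 + C y * X + C x - (C z' * X ^ 2 + C y' * X + C x') = 0 := by
    by_contra h0
    refine (monicCubic_monic a₂ a₁ a₀).not_dvd_of_degree_lt h0 ?_ h
    rw [monicCubic_degree]
    refine lt_of_le_of_lt (b := (2 : WithBot ℕ)) ?_ (by norm_num)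
    compute_degree
  rw [sub_eq_zero] at h2
  refine ⟨?_, ?_, ?_⟩
  · simpa [coeff_X, coeff_C] using congrArg (fun q ↦ coeff q 0) h2
  · simpa [coeff_X, coeff_C] using congrArg (fun q ↦ coeff q 1) h2
  · simpa [coeff_X, coeff_C] using congrArg (fun q ↦ coeff q 2) h2

theorem root_relation (a₂ a₁ a₀ : S) :
    AdjoinRoot.root (monicCubic a₂ a₁ a₀) ^ 3
      + AdjoinRoot.of _ a₂ * AdjoinRoot.root (monicCubic a₂ a₁ a₀) ^ 2
      + AdjoinRoot.of _ a₁ * AdjoinRoot.root (monicCubic a₂ a₁ a₀) + AdjoinRoot.of _ a₀ = 0 := by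
  rw [← AdjoinRoot.mk_self (f := monicCubic a₂ a₁ a₀)]
  conv_rhs => arg 2; unfold monicCubic
  simp only [map_add, map_mul, map_pow, AdjoinRoot.mk_C, AdjoinRoot.mk_X]

theorem cubicMul_iff [Nontrivial S] {a₂ a₁ a₀ x y z x' y' z' r₀ r₁ r₂ : S} :
    CubicMul a₂ a₁ a₀ x y z x' y' z' r₀ r₁ r₂ ↔
      cubicElt a₂ a₁ a₀ x y z * cubicElt a₂ a₁ a₀ x' y' z' = cubicElt a₂ a₁ a₀ r₀ r₁ r₂ := by
  have h : cubicElt a₂ a₁ a₀ x y z * cubicElt a₂ a₁ a₀ x' y' z' = cubicElt a₂ a₁ a₀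
      (x * x' - a₀ * (y * z' + z * y') + a₀ * a₂ * (z * z'))
      (x * y' + y * x' - a₁ * (y * z' + z * y') + (a₁ * a₂ - a₀) * (z * z'))
      (x * z' + y * y' + z * x' - a₂ * (y * z' + z * y') + (a₂ ^ 2 - a₁) * (z * z')) := by
    simp only [cubicElt, map_add, map_sub, map_mul, map_pow]
    set θ := AdjoinRoot.root (monicCubic a₂ a₁ a₀)
    set φ := AdjoinRoot.of (monicCubic a₂ a₁ a₀)
    linear_combination (φ z * φ z' * θ + (φ y * φ z' + φ z * φ y') - φ a₂ * φ z * φ z')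
      * root_relation a₂ a₁ a₀
  rw [h]
  constructor
  · rintro ⟨h₀, h₁, h₂⟩; rw [h₀, h₁, h₂]
  · intro h'
    obtain ⟨h₀, h₁, h₂⟩ := cubicElt_injective h'
    exact ⟨h₀, h₁, h₂⟩

/-- `cubicNorm` is the determinant of multiplication by the element, expanded along the constant
coefficients. The cofactors of that expansion are the coordinates of `g`. -/
theorem exists_cubicElt_mul_eq_norm [Nontrivial S] (a₂ a₁ a₀ x y z : S) :
    ∃ g, cubicElt a₂ a₁ a₀ x y z * g = AdjoinRoot.of _ (cubicNorm a₂ a₁ a₀ x y z) := by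
  refine ⟨cubicElt a₂ a₁ a₀ ((x - a₁ * z) * (x - a₁ * z - a₂ * (y - a₂ * z))
      - (-a₀ * z - a₁ * (y - a₂ * z)) * (y - a₂ * z))
      (-(y * (x - a₁ * z - a₂ * (y - a₂ * z)) - (-a₀ * z - a₁ * (y - a₂ * z)) * z))
      (y * (y - a₂ * z) - (x - a₁ * z) * z), ?_⟩
  have : AdjoinRoot.of _ (cubicNorm a₂ a₁ a₀ x y z)
    = cubicElt a₂ a₁ a₀ (cubicNorm a₂ a₁ a₀ x y z) 0 0 := by simp [cubicElt]
  rw [this, ← cubicMul_iff]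
  constructor <;> (try simp only [cubicNorm]) <;> ring

theorem of_mul_cubicElt (a₂ a₁ a₀ c u v w : S) :
    AdjoinRoot.of _ c * cubicElt a₂ a₁ a₀ u v w = cubicElt a₂ a₁ a₀ (c * u) (c * v) (c * w) := by
  simp only [cubicElt, map_mul]; ring

/-- Constants act coordinatewise on the basis `1, θ, θ²`, so they cancel as soon as they cancel in
`S`. -/
theorem of_mul_cancel [IsDomain S] {a₂ a₁ a₀ c : S} (hc : c ≠ 0)
    {r r' : AdjoinRoot (monicCubic a₂ a₁ a₀)}
    (h : AdjoinRoot.of _ c * r = AdjoinRoot.of _ c * r') : r = r' := by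
  obtain ⟨x, y, z, rfl⟩ := exists_eq_cubicElt r
  obtain ⟨x', y', z', rfl⟩ := exists_eq_cubicElt r'
  rw [of_mul_cubicElt, of_mul_cubicElt] at h
  obtain ⟨h₀, h₁, h₂⟩ := cubicElt_injective h
  rw [mul_left_cancel₀ hc h₀, mul_left_cancel₀ hc h₁, mul_left_cancel₀ hc h₂]

/-- If `γ γ' = n - θ`, then the norm of `γ = x + y θ + z θ²` divides `x + y n + z n²`. -/
theorem CubicMul.norm_dvd_eval [IsDomain S] {a₂ a₁ a₀ n x y z x' y' z' : S}
    (h : CubicMul a₂ a₁ a₀ x y z x' y' z' n (-1) 0)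
    (hn : n ^ 3 + a₂ * n ^ 2 + a₁ * n + a₀ ≠ 0) :
    cubicNorm a₂ a₁ a₀ x y z ∣ x + y * n + z * n ^ 2 := by
  have hN := h.cubicNorm_mul
  rw [cubicNorm_sub_root] at hN
  rw [cubicMul_iff] at h
  obtain ⟨g, hg⟩ := exists_cubicElt_mul_eq_norm a₂ a₁ a₀ x y z
  obtain ⟨g', hg'⟩ := exists_cubicElt_mul_eq_norm a₂ a₁ a₀ x' y' z'
  set ν := cubicNorm a₂ a₁ a₀ x y z
  set ν' := cubicNorm a₂ a₁ a₀ x' y' z'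
  set θ := AdjoinRoot.root (monicCubic a₂ a₁ a₀) with hθ
  set φ := AdjoinRoot.of (monicCubic a₂ a₁ a₀) with hφ
  set γ := cubicElt a₂ a₁ a₀ x y z with hγ
  set γ' := cubicElt a₂ a₁ a₀ x' y' z'
  set P := n ^ 3 + a₂ * n ^ 2 + a₁ * n + a₀
  have hlin : cubicElt a₂ a₁ a₀ n (-1) 0 = φ n - θ := by simp [cubicElt, φ, θ]; ring
  rw [hlin] at h
  -- `κ` is `(p(n) - p(θ)) / (n - θ)`. Its `θ²` coefficient is `1`, so a divisibility of `φ c * κ`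
  -- by `φ ν` descends to `ν ∣ c`.
  set κ := cubicElt a₂ a₁ a₀ (n ^ 2 + a₂ * n + a₁) (n + a₂) 1 with hκ
  have hκ1 : (φ n - θ) * κ = φ P := by
    simp only [hκ, cubicElt, P, map_add, map_mul, map_pow, map_one]
    rw [← hθ, ← hφ]
    linear_combination -root_relation a₂ a₁ a₀
  have hκ2 : g * g' = κ := by
    refine of_mul_cancel hn ?_
    rw [← hφ]
    calc φ P * (g * g') = ((φ n - θ) * κ) * (g * g') := by rw [hκ1]
      _ = (γ * g) * (γ' * g') * κ := by rw [← h]; ring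
      _ = φ P * κ := by rw [hg, hg', ← map_mul, hN]
  obtain ⟨u, v, w, hw⟩ := exists_eq_cubicElt (g' - (φ y + φ z * (φ n + θ)) * φ ν' * -1)
  refine ⟨w, ?_⟩
  have h1 : φ (x + y * n + z * n ^ 2) * κ = φ ν * cubicElt a₂ a₁ a₀ u v w := by
    rw [← hw]
    have e1 : γ * κ = φ ν * g' := by rw [← hκ2, ← hg]; ring
    have e2 : φ (x + y * n + z * n ^ 2) = γ + (φ n - θ) * (φ y + φ z * (φ n + θ)) := by
      simp only [hγ, cubicElt, map_add, map_mul, map_pow]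
      rw [← hθ, ← hφ]; ring
    have e3 : φ P = φ ν * φ ν' := by rw [← map_mul, hN]
    rw [e2]
    linear_combination e1 + (φ y + φ z * (φ n + θ)) * (hκ1 + e3)
  rw [hκ, of_mul_cubicElt, of_mul_cubicElt] at h1
  simpa using (cubicElt_injective h1).2.2

/-- Two factors of `n - θ`: if the norm of the first divides that of the second, then the first
divides the second. -/
theorem CubicMul.exists_cubicMul_of_norm_dvd [IsDomain S]
    {a₂ a₁ a₀ n x y z x' y' z' X Y Z X' Y' Z' : S}
    (h : CubicMul a₂ a₁ a₀ x y z x' y' z' n (-1) 0)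
    (H : CubicMul a₂ a₁ a₀ X Y Z X' Y' Z' n (-1) 0)
    (hn : n ^ 3 + a₂ * n ^ 2 + a₁ * n + a₀ ≠ 0)
    (hd : cubicNorm a₂ a₁ a₀ x y z ∣ cubicNorm a₂ a₁ a₀ X Y Z) :
    ∃ η₀ η₁ η₂, CubicMul a₂ a₁ a₀ x y z η₀ η₁ η₂ X Y Z := by
  obtain ⟨c, hc⟩ := hd.trans (H.norm_dvd_eval hn)
  have hν : cubicNorm a₂ a₁ a₀ x y z ≠ 0 := by
    intro h0
    have := h.cubicNorm_mul
    rw [cubicNorm_sub_root, h0, zero_mul] at this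
    exact hn this.symm
  obtain ⟨g, hg⟩ := exists_cubicElt_mul_eq_norm a₂ a₁ a₀ x y z
  rw [cubicMul_iff] at h
  set ν := cubicNorm a₂ a₁ a₀ x y z
  set θ := AdjoinRoot.root (monicCubic a₂ a₁ a₀) with hθ
  set φ := AdjoinRoot.of (monicCubic a₂ a₁ a₀) with hφ
  have hlin : cubicElt a₂ a₁ a₀ n (-1) 0 = φ n - θ := by simp [cubicElt, φ, θ]; ring
  rw [hlin] at h
  -- Write `Γ = Γ(n) - (n - θ)(Y + Z(n + θ))`. Here `Γ(n) = c ν = c γ g` and `n - θ = γ γ'`, so `γ`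
  -- factors out and leaves this quotient.
  obtain ⟨η₀, η₁, η₂, hη⟩ := exists_eq_cubicElt
    (φ c * g - cubicElt a₂ a₁ a₀ x' y' z' * (φ Y + φ Z * (φ n + θ)))
  refine ⟨η₀, η₁, η₂, ?_⟩
  rw [cubicMul_iff, ← hη]
  have e2 : φ (X + Y * n + Z * n ^ 2)
      = cubicElt a₂ a₁ a₀ X Y Z + (φ n - θ) * (φ Y + φ Z * (φ n + θ)) := by
    simp only [cubicElt, map_add, map_mul, map_pow]
    rw [← hθ, ← hφ]; ring
  rw [hc, map_mul, ← hg] at e2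
  linear_combination e2 - (φ Y + φ Z * (φ n + θ)) * h
end

/-! ### Rigidity: the quotient of two controlled factors is a unit. -/

theorem GaussianInt.eq_zero_of_norm_toComplex_lt_one {x : GaussianInt}
    (h : ‖GaussianInt.toComplex x‖ < 1) : x = 0 := by
  rw [← GaussianInt.norm_eq_zero]
  have h1 : (x.norm : ℝ) < 1 := by
    rw [GaussianInt.intCast_real_norm, Complex.normSq_eq_norm_sq]
    exact pow_lt_one₀ (_root_.norm_nonneg _) h two_ne_zero
  have h2 : x.norm < 1 := by exact_mod_cast h1
  linarith [GaussianInt.norm_nonneg x]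

theorem CubicMul.map {S T : Type*} [CommRing S] [CommRing T] (f : S →+* T)
    {a₂ a₁ a₀ x y z x' y' z' r₀ r₁ r₂ : S} (h : CubicMul a₂ a₁ a₀ x y z x' y' z' r₀ r₁ r₂) :
    CubicMul (f a₂) (f a₁) (f a₀) (f x) (f y) (f z) (f x') (f y') (f z') (f r₀) (f r₁) (f r₂) := by
  obtain ⟨h₀, h₁, h₂⟩ := h
  constructor
  · rw [← h₀]; simp
  · rw [← h₁]; simp
  · rw [← h₂]; simp

theorem norm_add_mul_le {e y z p q : ℂ} {d m : ℝ} (hy : ‖y‖ ≤ d) (hz : ‖z‖ ≤ d)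
    (hp : ‖p‖ ≤ m) (hq : ‖q‖ ≤ m) : ‖e * (y * p + z * q)‖ ≤ 2 * ‖e‖ * (d * m) := by
  have hd : 0 ≤ d := (norm_nonneg y).trans hy
  have h1 : ‖y * p‖ ≤ d * m := by rw [norm_mul]; gcongr
  have h2 : ‖z * q‖ ≤ d * m := by rw [norm_mul]; gcongr
  calc ‖e * (y * p + z * q)‖ = ‖e‖ * ‖y * p + z * q‖ := norm_mul _ _
    _ ≤ ‖e‖ * (d * m + d * m) := by gcongr; exact (norm_add_le _ _).trans (add_le_add h1 h2)
    _ = _ := by ring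

theorem norm_mul_mul_le {e z q : ℂ} {d m : ℝ} (hz : ‖z‖ ≤ d) (hq : ‖q‖ ≤ m) :
    ‖e * (z * q)‖ ≤ ‖e‖ * (d * m) := by
  have hd : 0 ≤ d := (norm_nonneg z).trans hz
  rw [norm_mul, norm_mul]
  gcongr

set_option maxHeartbeats 1000000 in
/-- If `x` is much larger than `y`, `z` and `Y`, `Z`, then a quotient of `X + Y θ + Z θ²` by
`x + y θ + z θ²` is approximately `X / x`, hence has small second and third coordinates. -/
theorem CubicMul.exists_norm_lt_one (a₂ a₁ a₀ : ℂ) {K₁ K₂ : ℝ} (hK₁ : 0 ≤ K₁) (hK₂ : 0 ≤ K₂) :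
    ∃ H₀ : ℝ, ∀ H ≥ H₀, ∀ x y z η₀ η₁ η₂ X Y Z : ℂ, CubicMul a₂ a₁ a₀ x y z η₀ η₁ η₂ X Y Z →
      H ^ 3 ≤ ‖x‖ → ‖y‖ ≤ K₁ * H → ‖z‖ ≤ K₁ * H → ‖X‖ ≤ K₂ * H ^ 3 → ‖Y‖ ≤ K₁ * H →
      ‖Z‖ ≤ K₁ * H → ‖η₁‖ < 1 ∧ ‖η₂‖ < 1 := by
  set L : ℝ := 2 + 2 * ‖a₀‖ + ‖a₀ * a₂‖ + 2 * ‖a₁‖ + ‖a₁ * a₂ - a₀‖ + 2 * ‖a₂‖ + ‖a₂ ^ 2 - a₁‖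
    with hL
  set M : ℝ := 2 * K₂ + 4 * K₁ with hM
  have hL0 : 0 ≤ L := by positivity
  have hM0 : 0 ≤ M := by positivity
  refine ⟨2 + 6 * L * K₁ + K₁ * (1 + L * M), ?_⟩
  intro H hH x y z η₀ η₁ η₂ X Y Z h hx hy hz hX hY hZ
  have hLK : 0 ≤ 6 * L * K₁ := by positivity
  have hKM : 0 ≤ K₁ * (1 + L * M) := by positivity
  have hH1 : 1 ≤ H := by linarith
  have hH2 : H ≤ H ^ 2 := by nlinarith
  set d := K₁ * H with hd
  have hd0 : 0 ≤ d := by positivity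
  set m := ‖η₀‖ + ‖η₁‖ + ‖η₂‖ with hm
  have hm0 : 0 ≤ m := by positivity
  have m0 : ‖η₀‖ ≤ m := by linarith [norm_nonneg η₁, norm_nonneg η₂]
  have m1 : ‖η₁‖ ≤ m := by linarith [norm_nonneg η₀, norm_nonneg η₂]
  have m2 : ‖η₂‖ ≤ m := by linarith [norm_nonneg η₁, norm_nonneg η₀]
  have hdm : 0 ≤ d * m := by positivity
  obtain ⟨e₀, e₁, e₂⟩ := h
  have hx0 : 0 ≤ ‖x‖ := norm_nonneg x
  have b₀ : H ^ 3 * ‖η₀‖ ≤ K₂ * H ^ 3 + L * (d * m) := by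
    have e : x * η₀ = X + a₀ * (y * η₂ + z * η₁) - (a₀ * a₂) * (z * η₂) := by
      linear_combination e₀
    calc H ^ 3 * ‖η₀‖ ≤ ‖x * η₀‖ := by rw [norm_mul]; gcongr
      _ ≤ ‖X‖ + ‖a₀ * (y * η₂ + z * η₁)‖ + ‖(a₀ * a₂) * (z * η₂)‖ := by
        rw [e]; exact (norm_sub_le _ _).trans (by gcongr; exact norm_add_le _ _)
      _ ≤ K₂ * H ^ 3 + 2 * ‖a₀‖ * (d * m) + ‖a₀ * a₂‖ * (d * m) := by
        gcongr
        · exact norm_add_mul_le hy hz m2 m1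
        · exact norm_mul_mul_le hz m2
      _ = K₂ * H ^ 3 + (2 * ‖a₀‖ + ‖a₀ * a₂‖) * (d * m) := by ring
      _ ≤ _ := by
        gcongr
        rw [hL]
        linarith [norm_nonneg a₀, norm_nonneg a₁, norm_nonneg a₂, norm_nonneg (a₁ * a₂ - a₀),
          norm_nonneg (a₂ ^ 2 - a₁)]
  have b₁ : H ^ 3 * ‖η₁‖ ≤ d + L * (d * m) := by
    have e : x * η₁ = Y - 1 * (y * η₀) + a₁ * (y * η₂ + z * η₁) - (a₁ * a₂ - a₀) * (z * η₂) := by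
      linear_combination e₁
    calc H ^ 3 * ‖η₁‖ ≤ ‖x * η₁‖ := by rw [norm_mul]; gcongr
      _ ≤ ‖Y‖ + ‖1 * (y * η₀)‖ + ‖a₁ * (y * η₂ + z * η₁)‖
          + ‖(a₁ * a₂ - a₀) * (z * η₂)‖ := by
        rw [e]
        refine (norm_sub_le _ _).trans ?_
        gcongr
        refine (norm_add_le _ _).trans ?_
        gcongr
        exact norm_sub_le _ _
      _ ≤ d + ‖(1 : ℂ)‖ * (d * m) + 2 * ‖a₁‖ * (d * m) + ‖a₁ * a₂ - a₀‖ * (d * m) := by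
        gcongr
        · exact norm_mul_mul_le hy m0
        · exact norm_add_mul_le hy hz m2 m1
        · exact norm_mul_mul_le hz m2
      _ = d + (1 + 2 * ‖a₁‖ + ‖a₁ * a₂ - a₀‖) * (d * m) := by rw [norm_one]; ring
      _ ≤ _ := by
        gcongr
        rw [hL]
        linarith [norm_nonneg a₀, norm_nonneg a₁, norm_nonneg a₂, norm_nonneg (a₀ * a₂),
          norm_nonneg (a₂ ^ 2 - a₁)]
  have b₂ : H ^ 3 * ‖η₂‖ ≤ d + L * (d * m) := by
    have e : x * η₂ = Z - 1 * (y * η₁ + z * η₀) + a₂ * (y * η₂ + z * η₁)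
        - (a₂ ^ 2 - a₁) * (z * η₂) := by
      linear_combination e₂
    calc H ^ 3 * ‖η₂‖ ≤ ‖x * η₂‖ := by rw [norm_mul]; gcongr
      _ ≤ ‖Z‖ + ‖1 * (y * η₁ + z * η₀)‖ + ‖a₂ * (y * η₂ + z * η₁)‖
          + ‖(a₂ ^ 2 - a₁) * (z * η₂)‖ := by
        rw [e]
        refine (norm_sub_le _ _).trans ?_
        gcongr
        refine (norm_add_le _ _).trans ?_
        gcongr
        exact norm_sub_le _ _
      _ ≤ d + 2 * ‖(1 : ℂ)‖ * (d * m) + 2 * ‖a₂‖ * (d * m) + ‖a₂ ^ 2 - a₁‖ * (d * m) := by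
        gcongr
        · exact norm_add_mul_le hy hz m1 m0
        · exact norm_add_mul_le hy hz m2 m1
        · exact norm_mul_mul_le hz m2
      _ = d + (2 + 2 * ‖a₂‖ + ‖a₂ ^ 2 - a₁‖) * (d * m) := by rw [norm_one]; ring
      _ ≤ _ := by
        gcongr
        rw [hL]
        linarith [norm_nonneg a₀, norm_nonneg a₁, norm_nonneg a₂, norm_nonneg (a₀ * a₂),
          norm_nonneg (a₁ * a₂ - a₀)]
  have hH0 : 0 < H := by linarith
  -- Bootstrap: summing the three bounds gives `H³ m ≤ K₂ H³ + 2 d + 3 L d m`. Since `d = K₁ H` is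
  -- small beside `H³`, the last term is absorbed on the left. The resulting bound on `m`, put back
  -- into `b₁` and `b₂`, gives the claim.
  have hmM : m ≤ M := by
    have h1 : H ^ 3 * m ≤ K₂ * H ^ 3 + 2 * d + 3 * (L * (d * m)) := by 
      rw [hm, mul_add, mul_add]; linarith
    have h2 : 6 * (L * (d * m)) ≤ H ^ 3 * m := by
      have : 6 * L * K₁ ≤ H ^ 2 := by linarith
      calc 6 * (L * (d * m)) = 6 * L * K₁ * (H * m) := by rw [hd]; ring
        _ ≤ H ^ 2 * (H * m) := by gcongr
        _ = _ := by ring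
    have h3 : d ≤ K₁ * H ^ 3 := by
      rw [hd]; gcongr; exact le_self_pow₀ hH1 (by norm_num)
    have h4 : H ^ 3 * m ≤ H ^ 3 * M := by rw [hM]; linarith
    exact le_of_mul_le_mul_left h4 (by positivity)
  have hlast : d + L * (d * m) < H ^ 3 := by
    calc d + L * (d * m) ≤ d + L * (d * M) := by gcongr
      _ = K₁ * (1 + L * M) * H := by rw [hd]; ring
      _ < H ^ 2 * H := by gcongr; linarith
      _ = _ := by ring
  have hH3 : 0 < H ^ 3 := by positivity
  exact ⟨by nlinarith, by nlinarith⟩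

/-- A Gaussian integer of modulus below one vanishes, so the quotient reduces to its constant
coordinate `η₀`. -/
theorem CubicMul.exists_coeff_eq_zero (a₂ a₁ a₀ : ℤ) {K₁ K₂ : ℝ} (hK₁ : 0 ≤ K₁) (hK₂ : 0 ≤ K₂) :
    ∃ H₀ : ℝ, ∀ H ≥ H₀, ∀ x y z η₀ η₁ η₂ X Y Z : GaussianInt,
      CubicMul (a₂ : GaussianInt) a₁ a₀ x y z η₀ η₁ η₂ X Y Z →
      H ^ 3 ≤ ‖x.toComplex‖ → ‖y.toComplex‖ ≤ K₁ * H → ‖z.toComplex‖ ≤ K₁ * H →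
      ‖X.toComplex‖ ≤ K₂ * H ^ 3 → ‖Y.toComplex‖ ≤ K₁ * H → ‖Z.toComplex‖ ≤ K₁ * H →
      Y = y * η₀ ∧ Z = z * η₀ := by
  obtain ⟨H₀, h₀⟩ := CubicMul.exists_norm_lt_one a₂ a₁ a₀ hK₁ hK₂
  refine ⟨H₀, fun H hH x y z η₀ η₁ η₂ X Y Z h hx hy hz hX hY hZ ↦ ?_⟩
  have h' := h.map GaussianInt.toComplex
  simp only [map_intCast] at h'
  obtain ⟨h₁, h₂⟩ := h₀ H hH _ _ _ _ _ _ _ _ _ h' hx hy hz hX hY hZ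
  have e₁ := GaussianInt.eq_zero_of_norm_toComplex_lt_one h₁
  have e₂ := GaussianInt.eq_zero_of_norm_toComplex_lt_one h₂
  subst e₁ e₂
  exact ⟨by simpa using h.coeff_one.symm, by simpa using h.coeff_two.symm⟩

/-- Two integer matrices of determinant one which differ by a Gaussian integer and whose second
rows lie in the wedge `0 < t < w` have the same second row. -/
theorem eq_of_eq_mul_of_wedge {v s w t v' s' w' t' : ℤ} {η : GaussianInt}
    (hV : (⟨v', s'⟩ : GaussianInt) = ⟨v, s⟩ * η) (hW : (⟨w', t'⟩ : GaussianInt) = ⟨w, t⟩ * η)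
    (hd : v * t - w * s = 1) (hd' : v' * t' - w' * s' = 1)
    (ht : 0 < t) (htw : t < w) (ht' : 0 < t') (htw' : t' < w') : w' = w ∧ t' = t := by
  obtain ⟨p, q⟩ := η
  simp only [Zsqrtd.ext_iff, Zsqrtd.re_mul, Zsqrtd.im_mul] at hV hW
  obtain ⟨hv, hs⟩ := hV
  obtain ⟨hw, ht0⟩ := hW
  -- Multiplication by `η` multiplies the determinant by the norm of `η`, so `η` is one of `±1, ±i`;
  -- only `1` preserves the wedge.
  have hu : p ^ 2 + q ^ 2 = 1 := by
    have : v' * t' - w' * s' = (v * t - w * s) * (p ^ 2 + q ^ 2) := by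
      rw [hv, hs, hw, ht0]; ring
    rw [hd, hd', one_mul] at this
    exact this.symm
  have hp1 : p ≤ 1 := by nlinarith [sq_nonneg q]
  have hp2 : -1 ≤ p := by nlinarith [sq_nonneg q]
  have hq1 : q ≤ 1 := by nlinarith [sq_nonneg p]
  have hq2 : -1 ≤ q := by nlinarith [sq_nonneg p]
  interval_cases p <;> interval_cases q <;> simp at hu <;> omega

/-! ### Construction of factors of `n - θ` and their sizes. -/

/-- The factor `u + i r + (v + i s) θ + (w + i t) θ²` of `n - θ`, given `v t - w s = 1`. -/
theorem cubicMul_conj_of_det_eq_one {a₂ a₁ a₀ v s w t e₁ e₂ : ℤ} (hdet : v * t - w * s = 1)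
    (he₁ : 2 * e₁ = -(v ^ 2 + s ^ 2 + (a₂ ^ 2 - a₁) * (w ^ 2 + t ^ 2) - 2 * a₂ * (v * w + s * t)))
    (he₂ : 2 * e₂ = -(1 + (a₁ * a₂ - a₀) * (w ^ 2 + t ^ 2) - 2 * a₁ * (v * w + s * t))) :
    CubicMul (a₂ : GaussianInt) a₁ a₀ ⟨t * e₂ - s * e₁, v * e₁ - w * e₂⟩ ⟨v, s⟩ ⟨w, t⟩
      ⟨t * e₂ - s * e₁, -(v * e₁ - w * e₂)⟩ ⟨v, -s⟩ ⟨w, -t⟩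
      (((t * e₂ - s * e₁) ^ 2 + (v * e₁ - w * e₂) ^ 2 + a₀ * a₂ * (w ^ 2 + t ^ 2)
        - 2 * a₀ * (v * w + s * t) : ℤ) : GaussianInt) (-1) 0 := by
  constructor
  · ext <;> simp [pow_two] <;> ring
  · ext
    · simp
      linear_combination 2 * e₂ * hdet + he₂
    · simp; ring
  · ext
    · simp [pow_two]
      linear_combination 2 * e₁ * hdet + he₁
    · simp [pow_two]; ring

theorem cubicNorm_conj (a₂ a₁ a₀ : ℤ) (x y z : GaussianInt) :
    cubicNorm (a₂ : GaussianInt) a₁ a₀ (star x) (star y) (star z)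
      = star (cubicNorm (a₂ : GaussianInt) a₁ a₀ x y z) := by
  have := cubicNorm_map (starRingEnd GaussianInt) (a₂ : GaussianInt) a₁ a₀ x y z
  simp only [map_intCast] at this
  exact this.symm

/-- A bottom row `(w, t)` with coprime entries, `w` even, extends to a matrix of determinant one
with odd top row, of any prescribed size. -/
theorem exists_odd_row {w t M : ℤ} (hM : 1 ≤ M) (hw : Even w) (ht : 0 < t) (htw : t < w)
    (hc : IsCoprime w t) : ∃ v s : ℤ, v * t - w * s = 1 ∧ Odd v ∧ Odd s ∧
      M * w ≤ v ∧ v < (M + 2) * w ∧ 0 ≤ s ∧ s ≤ v := by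
  have hw0 : 0 < w := ht.trans htw
  have main : ∀ v s : ℤ, v * t - w * s = 1 → M * w ≤ v → Odd v ∧ 0 ≤ s ∧ s ≤ v := by
    intro v s h hv
    have hv0 : 0 < v := by nlinarith
    refine ⟨?_, ?_, ?_⟩
    · have h1 : Odd (v * t) := by
        have : v * t = 1 + w * s := by linarith
        rw [this]
        exact odd_one.add_even (hw.mul_right s)
      exact (Int.odd_mul.1 h1).1
    · by_contra! hs
      nlinarith
    · by_contra! hs
      nlinarith
  obtain ⟨p, q, hpq⟩ := hc
  have hdiv := Int.emod_add_mul_ediv q w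
  have hlt := Int.emod_lt_of_pos q hw0
  have hnn := Int.emod_nonneg q hw0.ne'
  -- All completions of `(w, t)` are `(q + k w, -p + k t)`. This `k` puts `v` in `[M w, (M + 1) w)`.
  set k := M - q / w with hk
  have e1 : (q + k * w) = M * w + q % w := by rw [hk]; linear_combination -hdiv
  have htodd : Odd t := by
    have h1 : Odd (q * t) := by
      have : q * t = 1 - p * w := by linarith
      rw [this]
      exact odd_one.sub_even (hw.mul_left p)
    exact (Int.odd_mul.1 h1).2
  -- As `t` is odd, passing from `k` to `k + 1` flips the parity of `s`; hence the room up to `(M +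
  -- 2) w`.
  rcases Int.even_or_odd (-p + k * t) with hs | hs
  · have h1 : (q + (k + 1) * w) * t - w * (-p + (k + 1) * t) = 1 := by linear_combination hpq
    have h2 : M * w ≤ q + (k + 1) * w := by linarith
    obtain ⟨m1, m2, m3⟩ := main _ _ h1 h2
    refine ⟨_, _, h1, m1, ?_, h2, by linarith, m2, m3⟩
    have : -p + (k + 1) * t = (-p + k * t) + t := by ring
    rw [this]
    exact hs.add_odd htodd
  · have h1 : (q + k * w) * t - w * (-p + k * t) = 1 := by linear_combination hpq
    have h2 : M * w ≤ q + k * w := by linarith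
    obtain ⟨m1, m2, m3⟩ := main _ _ h1 h2
    exact ⟨_, _, h1, m1, hs, h2, by linarith, m2, m3⟩

/-- This is where the parity conditions on `p` enter. `v² + s²` is even because `v, s` are odd; `w²
+ t²` is odd because `w` is even and the determinant forces `t` odd, so `1 + (a₁ a₂ - a₀)(w² + t²)`
is even. -/
theorem exists_half_eq {a₂ a₁ a₀ v s w t : ℤ} (hA : Even (a₂ ^ 2 - a₁)) (hB : Odd (a₁ * a₂ - a₀))
    (hv : Odd v) (hs : Odd s) (hw : Even w) (hdet : v * t - w * s = 1) :
    ∃ e₁ e₂ : ℤ,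
      2 * e₁ = -(v ^ 2 + s ^ 2 + (a₂ ^ 2 - a₁) * (w ^ 2 + t ^ 2) - 2 * a₂ * (v * w + s * t)) ∧
      2 * e₂ = -(1 + (a₁ * a₂ - a₀) * (w ^ 2 + t ^ 2) - 2 * a₁ * (v * w + s * t)) := by
  have ht : Odd t := by
    have h1 : Odd (v * t) := by
      have : v * t = 1 + w * s := by linarith
      rw [this]
      exact odd_one.add_even (hw.mul_right s)
    exact (Int.odd_mul.1 h1).2
  have hc : Odd (w ^ 2 + t ^ 2) := (hw.pow_of_ne_zero two_ne_zero).add_odd ht.pow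
  obtain ⟨p, hp⟩ := (hv.pow (n := 2)).add_odd (hs.pow (n := 2))
  obtain ⟨q, hq⟩ := hA
  obtain ⟨k, hk⟩ := odd_one.add_odd (hB.mul hc)
  refine ⟨-(p + q * (w ^ 2 + t ^ 2) - a₂ * (v * w + s * t)), -(k - a₁ * (v * w + s * t)), ?_, ?_⟩
  · rw [hp, hq]; ring
  · rw [hk]; ring

set_option maxHeartbeats 800000 in
/-- Size estimates for the coefficients of the factor of `n - θ`. -/
theorem factor_size {a₂ a₁ a₀ v s w t e₁ e₂ : ℤ}
    (he₁ : 2 * e₁ = -(v ^ 2 + s ^ 2 + (a₂ ^ 2 - a₁) * (w ^ 2 + t ^ 2) - 2 * a₂ * (v * w + s * t)))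
    (he₂ : 2 * e₂ = -(1 + (a₁ * a₂ - a₀) * (w ^ 2 + t ^ 2) - 2 * a₁ * (v * w + s * t)))
    {M : ℤ} (hM : 4 + 4 * |a₂ ^ 2 - a₁| + 8 * |a₂| + 2 * |a₁ * a₂ - a₀| + 4 * |a₁| ≤ M)
    (ht : 0 < t) (htw : t < w) (hv : M * w ≤ v) (hs : 0 ≤ s) (hsv : s ≤ v) :
    v ^ 3 ≤ 8 * |v * e₁ - w * e₂| ∧ |v * e₁ - w * e₂| ≤ 2 * v ^ 3 ∧ |t * e₂ - s * e₁| ≤ 2 * v ^ 3 ∧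
      |a₀ * a₂ * (w ^ 2 + t ^ 2) - 2 * a₀ * (v * w + s * t)|
        ≤ (2 * |a₀ * a₂| + 4 * |a₀|) * v ^ 2 := by
  have n1 := abs_nonneg (a₂ ^ 2 - a₁)
  have n2 := abs_nonneg a₂
  have n3 := abs_nonneg (a₁ * a₂ - a₀)
  have n4 := abs_nonneg a₁
  have hw : 0 < w := ht.trans htw
  have hM4 : 4 ≤ M := by linarith
  have hwv : 4 * w ≤ v := by nlinarith
  have hv0 : 0 < v := by linarith
  have hMvw : M * (v * w) ≤ v ^ 2 := by nlinarith
  have hww : w ^ 2 ≤ v * w := by nlinarith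
  have hc : w ^ 2 + t ^ 2 ≤ 2 * (v * w) := by nlinarith
  have hc' : 0 ≤ w ^ 2 + t ^ 2 := by positivity
  have hb : v * w + s * t ≤ 2 * (v * w) := by nlinarith
  have hb' : 0 ≤ v * w + s * t := by positivity
  have hvw1 : 1 ≤ v * w := by nlinarith
  have bound : ∀ k l : ℤ, |k * (w ^ 2 + t ^ 2) - 2 * l * (v * w + s * t)|
      ≤ (2 * |k| + 4 * |l|) * (v * w) := by
    intro k l
    calc |k * (w ^ 2 + t ^ 2) - 2 * l * (v * w + s * t)|
        ≤ |k * (w ^ 2 + t ^ 2)| + |2 * l * (v * w + s * t)| := abs_sub _ _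
      _ = |k| * (w ^ 2 + t ^ 2) + 2 * |l| * (v * w + s * t) := by
        rw [abs_mul, abs_mul, abs_mul, abs_of_nonneg hc', abs_of_nonneg hb', abs_two]
      _ ≤ |k| * (2 * (v * w)) + 2 * |l| * (2 * (v * w)) := by gcongr
      _ = _ := by ring
  have b₁ := bound (a₂ ^ 2 - a₁) a₂
  have b₂ := bound (a₁ * a₂ - a₀) a₁
  have d₁ : 2 * ((2 * |a₂ ^ 2 - a₁| + 4 * |a₂|) * (v * w)) ≤ v ^ 2 := by
    refine le_trans ?_ hMvw
    rw [← mul_assoc]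
    gcongr
    linarith
  have d₂ : 1 + (2 * |a₁ * a₂ - a₀| + 4 * |a₁|) * (v * w) ≤ v ^ 2 := by
    refine le_trans ?_ hMvw
    calc 1 + (2 * |a₁ * a₂ - a₀| + 4 * |a₁|) * (v * w)
        ≤ 1 * (v * w) + (2 * |a₁ * a₂ - a₀| + 4 * |a₁|) * (v * w) := by linarith
      _ = (1 + (2 * |a₁ * a₂ - a₀| + 4 * |a₁|)) * (v * w) := by ring
      _ ≤ _ := by gcongr; linarith
  rw [abs_le] at b₁ b₂
  have hs2 : s ^ 2 ≤ v ^ 2 := by gcongr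
  have s2 : 0 ≤ s ^ 2 := sq_nonneg s
  -- The choice of `M` makes every term involving a coefficient of `p` small beside `v²`: `e₁` is
  -- `-(v² + s²)/2` up to `v²/4`, and `|e₂| ≤ v²/2`. Hence `v e₁` dominates `w e₂`.
  have e₁l : 4 * e₁ ≤ -v ^ 2 := by linarith [b₁.1]
  have e₁u : -(5 * v ^ 2) ≤ 4 * e₁ := by linarith [b₁.2]
  have e₂l : 2 * e₂ ≤ v ^ 2 := by linarith [b₂.1]
  have e₂u : -v ^ 2 ≤ 2 * e₂ := by linarith [b₂.2]
  have v2 : 0 ≤ v ^ 2 := sq_nonneg v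
  have p₁ : 4 * (v * e₁) ≤ -v ^ 3 := by linarith [mul_le_mul_of_nonneg_left e₁l hv0.le]
  have p₂ : -(5 * v ^ 3) ≤ 4 * (v * e₁) := by linarith [mul_le_mul_of_nonneg_left e₁u hv0.le]
  have hwv2 : 4 * (w * v ^ 2) ≤ v ^ 3 := by linarith [mul_le_mul_of_nonneg_right hwv v2]
  have p₃ : 8 * (w * e₂) ≤ v ^ 3 := by linarith [mul_le_mul_of_nonneg_left e₂l hw.le]
  have p₄ : -v ^ 3 ≤ 8 * (w * e₂) := by linarith [mul_le_mul_of_nonneg_left e₂u hw.le]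
  have hv3 : 0 < v ^ 3 := by positivity
  have htv2 : t * v ^ 2 ≤ w * v ^ 2 := mul_le_mul_of_nonneg_right htw.le v2
  have p₅ : 8 * (t * e₂) ≤ v ^ 3 := by linarith [mul_le_mul_of_nonneg_left e₂l ht.le]
  have p₆ : -v ^ 3 ≤ 8 * (t * e₂) := by linarith [mul_le_mul_of_nonneg_left e₂u ht.le]
  have hsv2 : s * v ^ 2 ≤ v ^ 3 := by linarith [mul_le_mul_of_nonneg_right hsv v2]
  have p₇ : s * e₁ ≤ 0 := by
    linarith [mul_le_mul_of_nonneg_left e₁l hs, mul_nonneg hs v2]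
  have p₈ : -(5 * v ^ 3) ≤ 4 * (s * e₁) := by linarith [mul_le_mul_of_nonneg_left e₁u hs]
  refine ⟨?_, ?_, ?_, ?_⟩
  · rw [abs_of_neg (by linarith)]; linarith
  · rw [abs_le]; constructor <;> linarith
  · rw [abs_le]; constructor <;> linarith
  · refine (bound _ _).trans ?_
    gcongr
    nlinarith

theorem GaussianInt.norm_toComplex_le (p q : ℤ) :
    ‖GaussianInt.toComplex ⟨p, q⟩‖ ≤ ((|p| + |q| : ℤ) : ℝ) := by
  have := Complex.norm_le_abs_re_add_abs_im (GaussianInt.toComplex ⟨p, q⟩)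
  simpa using this

theorem GaussianInt.abs_im_le_norm_toComplex (p q : ℤ) :
    ((|q| : ℤ) : ℝ) ≤ ‖GaussianInt.toComplex ⟨p, q⟩‖ := by
  have := Complex.abs_im_le_norm (GaussianInt.toComplex ⟨p, q⟩)
  simpa using this

/-- A factor `x + y θ + z θ²` of `n - θ` whose size is controlled by `H`. -/
structure IsControlledFactor (a₂ a₁ a₀ : ℤ) (K : ℝ) (H : ℕ) (n : ℤ) (x y z : GaussianInt) :
    Prop where
  cubicMul : CubicMul (a₂ : GaussianInt) a₁ a₀ x y z (star x) (star y) (star z) (n : GaussianInt)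
    (-1) 0
  det : y.re * z.im - z.re * y.im = 1
  le_norm : (H : ℝ) ^ 3 ≤ ‖x.toComplex‖
  norm_le : ‖x.toComplex‖ ≤ K * H ^ 3
  norm_snd_le : ‖y.toComplex‖ ≤ K * H
  norm_trd_le : ‖z.toComplex‖ ≤ K * H
  le_pow : (n : ℝ) ≤ K * H ^ 6

/-- The pairs `(u, t)` with `H ≤ u < 2 H` and `t < 2 u` coprime to `2 u`. -/
def coprimePairs (H : ℕ) : Finset (Σ _ : ℕ, ℕ) :=
  (Finset.Ico H (2 * H)).sigma fun u ↦ (Finset.range (2 * u)).filter (2 * u).Coprime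

set_option maxHeartbeats 400000 in
theorem exists_isControlledFactor {a₂ a₁ a₀ : ℤ} (hA : Even (a₂ ^ 2 - a₁))
    (hB : Odd (a₁ * a₂ - a₀)) (N₀ : ℤ) : ∃ K : ℝ, 0 ≤ K ∧ ∃ H₀ : ℕ, ∀ H ≥ H₀,
      ∀ p ∈ coprimePairs H, ∃ (n : ℤ) (x y : GaussianInt),
        N₀ ≤ n ∧ IsControlledFactor a₂ a₁ a₀ K H n x y ⟨2 * p.1, p.2⟩ := by
  set M : ℤ := 4 + 4 * |a₂ ^ 2 - a₁| + 8 * |a₂| + 2 * |a₁ * a₂ - a₀| + 4 * |a₁| with hM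
  have hM4 : 4 ≤ M := by
    linarith [abs_nonneg (a₂ ^ 2 - a₁), abs_nonneg a₂, abs_nonneg (a₁ * a₂ - a₀), abs_nonneg a₁]
  set E : ℤ := 2 * |a₀ * a₂| + 4 * |a₀| with hE
  have hE0 : 0 ≤ E := by positivity
  set Q : ℤ := 4 * (M + 2) with hQ
  have hQ1 : 1 ≤ Q := by linarith
  set K : ℤ := 4 * Q ^ 3 + 2 * Q + (8 + E) * Q ^ 6 with hK
  have k1 : 0 ≤ 4 * Q ^ 3 := by positivity
  have k2 : 0 ≤ 2 * Q := by positivity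
  have k3 : 0 ≤ (8 + E) * Q ^ 6 := by positivity
  -- With `v ≥ 64 (E + 1)`, the main term `r² ≥ v⁶/64` is at least `(E + 1) v²`; the error is at
  -- most `E v²`, so `n ≥ v² ≥ N₀`.
  refine ⟨K, by exact_mod_cast (by linarith : 0 ≤ K), (|N₀| + 64 * (E + 1)).toNat, ?_⟩
  rintro H hH ⟨u, t⟩ hp
  simp only [coprimePairs, Finset.mem_sigma, Finset.mem_Ico, Finset.mem_filter,
    Finset.mem_range] at hp
  obtain ⟨⟨hu1, hu2⟩, htu, hcop⟩ := hp
  have hH' : |N₀| + 64 * (E + 1) ≤ (H : ℤ) := by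
    have := Int.self_le_toNat (|N₀| + 64 * (E + 1)); omega
  have hH1 : (1 : ℤ) ≤ H := by linarith [abs_nonneg N₀]
  have ht0 : 0 < t := by
    rcases Nat.eq_zero_or_pos t with rfl | h
    · rw [Nat.coprime_zero_right] at hcop; omega
    · exact h
  have hcop' : IsCoprime ((2 * u : ℤ)) (t : ℤ) := by exact_mod_cast hcop.isCoprime
  have htw : (t : ℤ) < 2 * u := by exact_mod_cast htu
  have ht0' : (0 : ℤ) < t := by exact_mod_cast ht0
  have huH : (H : ℤ) ≤ u := by exact_mod_cast hu1
  have huH2 : (u : ℤ) < 2 * H := by exact_mod_cast hu2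
  obtain ⟨v, s, hdet, hv, hs, hv1, hv2, hs0, hsv⟩ :=
    exists_odd_row (M := M) (by linarith only [hM4]) (even_two_mul (u : ℤ)) ht0' htw hcop'
  obtain ⟨e₁, e₂, he₁, he₂⟩ := exists_half_eq hA hB hv hs (even_two_mul (u : ℤ)) hdet
  have hmul := cubicMul_conj_of_det_eq_one hdet he₁ he₂
  obtain ⟨b₁, b₂, b₃, b₄⟩ := factor_size (a₀ := a₀) he₁ he₂ hM.ge ht0' htw hv1 hs0 hsv
  have hvH : 2 * (H : ℤ) ≤ v := by
    linarith only [mul_le_mul_of_nonneg_right hM4 (by positivity : (0 : ℤ) ≤ 2 * u), hv1, huH]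
  have hvQ : v ≤ Q * H := by
    rw [hQ]
    linarith only [mul_le_mul_of_nonneg_left huH2.le (by linarith only [hM4] : 0 ≤ M + 2), hv2]
  have hv0 : 0 < v := by linarith only [hvH, hH1]
  set r := v * e₁ - 2 * (u : ℤ) * e₂ with hr
  set x := (t : ℤ) * e₂ - s * e₁ with hx
  set n := x ^ 2 + r ^ 2 + a₀ * a₂ * ((2 * (u : ℤ)) ^ 2 + (t : ℤ) ^ 2)
    - 2 * a₀ * (v * (2 * (u : ℤ)) + s * t) with hn
  rw [abs_le] at b₄
  have hr2 : v ^ 6 ≤ 64 * r ^ 2 := by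
    have := pow_le_pow_left₀ (by positivity) b₁ 2
    rw [mul_pow, sq_abs] at this
    linarith only [this]
  have hr2' : r ^ 2 ≤ 4 * v ^ 6 := by
    have := pow_le_pow_left₀ (abs_nonneg _) b₂ 2
    rw [sq_abs] at this
    linarith only [this]
  have hx2' : x ^ 2 ≤ 4 * v ^ 6 := by
    have := pow_le_pow_left₀ (abs_nonneg _) b₃ 2
    rw [sq_abs] at this
    linarith only [this]
  have hv3 : v ^ 3 ≤ Q ^ 3 * H ^ 3 := by
    rw [← mul_pow]; gcongr
  refine ⟨n, ⟨x, r⟩, ⟨v, s⟩, ?_, hmul, hdet, ?_, ?_, ?_, ?_, ?_⟩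
  · have h1 : 64 * (E + 1) ≤ v := by linarith only [abs_nonneg N₀, hvH, hH', hH1]
    have h2 : v ^ 2 * (64 * (E + 1)) ≤ v ^ 6 := by
      calc v ^ 2 * (64 * (E + 1)) ≤ v ^ 2 * v := by gcongr
        _ = v ^ 3 := by ring
        _ ≤ v ^ 6 := pow_le_pow_right₀ hv0 (by norm_num)
    have h3 : v ≤ v ^ 2 := le_self_pow₀ hv0 two_ne_zero
    have h4 := le_abs_self N₀
    have h5 := sq_nonneg x
    linarith only [b₄.1, hn, hr2, h1, h2, h3, h4, h5, hvH, hH', hH1, hE0]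
  · refine le_trans ?_ (GaussianInt.abs_im_le_norm_toComplex x r)
    have : (2 * (H : ℤ)) ^ 3 ≤ v ^ 3 := by gcongr
    exact_mod_cast (by linarith only [this, b₁] : (H : ℤ) ^ 3 ≤ |r|)
  · refine (GaussianInt.norm_toComplex_le x r).trans ?_
    have : |x| + |r| ≤ K * H ^ 3 := by
      have : 0 ≤ (2 * Q + (8 + E) * Q ^ 6) * H ^ 3 := by positivity
      rw [hK]; linarith only [this, b₂, b₃, hv3]
    exact_mod_cast this
  · refine (GaussianInt.norm_toComplex_le v s).trans ?_
    have : |v| + |s| ≤ K * H := by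
      rw [abs_of_pos hv0, abs_of_nonneg hs0]
      have : 0 ≤ (4 * Q ^ 3 + (8 + E) * Q ^ 6) * H := by positivity
      rw [hK]; linarith only [this, hsv, hvQ]
    exact_mod_cast this
  · refine (GaussianInt.norm_toComplex_le _ _).trans ?_
    have : |2 * (u : ℤ)| + |(t : ℤ)| ≤ K * H := by
      rw [abs_of_nonneg (by positivity), abs_of_nonneg (by positivity)]
      have h1 : 0 ≤ (4 * Q ^ 3 + (8 + E) * Q ^ 6) * H := by positivity
      have h2 : 4 * (H : ℤ) ≤ Q * H := by gcongr; linarith only [hQ, hM4]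
      rw [hK]; linarith only [h1, h2, huH2, htw]
    exact_mod_cast this
  · have h1 : n ≤ (8 + E) * v ^ 6 := by
      have h0 : v ^ 2 ≤ v ^ 6 := pow_le_pow_right₀ hv0 (by norm_num)
      have h1 : E * v ^ 2 ≤ E * v ^ 6 := by gcongr
      linarith only [b₄.2, hn, h1, hr2', hx2']
    have h2 : v ^ 6 ≤ Q ^ 6 * H ^ 6 := by
      rw [← mul_pow]; gcongr
    have h3 : n ≤ K * H ^ 6 := by
      have h4 : 0 ≤ (4 * Q ^ 3 + 2 * Q) * H ^ 6 := by positivity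
      have h5 : (8 + E) * v ^ 6 ≤ (8 + E) * (Q ^ 6 * H ^ 6) := by gcongr
      rw [hK]; linarith only [h1, h4, h5]
    exact_mod_cast h3

/-! ### The family of norms and its injectivity. -/

theorem cubic_pos {a₂ a₁ a₀ n : ℤ} (hn : 1 + |a₂| + |a₁| + |a₀| ≤ n) :
    0 < n ^ 3 + a₂ * n ^ 2 + a₁ * n + a₀ := by
  have n2 := abs_nonneg a₂
  have n1 := abs_nonneg a₁
  have n0 := abs_nonneg a₀
  have hn1 : 1 ≤ n := by linarith
  have h1 : n ≤ n ^ 2 := by nlinarith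
  have h2 : -(|a₂| * n ^ 2) ≤ a₂ * n ^ 2 := by nlinarith [neg_abs_le a₂, sq_nonneg n]
  have h3 : -(|a₁| * n ^ 2) ≤ a₁ * n := by nlinarith [neg_abs_le a₁]
  have h4 : -(|a₀| * n ^ 2) ≤ a₀ := by nlinarith [neg_abs_le a₀]
  nlinarith

/-- A large family of values of the cubic which are norms from `ℤ[i]`, indexed injectively by the
value of the argument together with the Gaussian integer up to divisibility. -/
theorem exists_norm_family {a₂ a₁ a₀ : ℤ} (hA : Even (a₂ ^ 2 - a₁)) (hB : Odd (a₁ * a₂ - a₀)) :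
    ∃ K : ℝ, 0 ≤ K ∧ ∃ H₀ : ℕ, ∀ H ≥ H₀, ∃ (n : (Σ _ : ℕ, ℕ) → ℤ) (ν : (Σ _ : ℕ, ℕ) → GaussianInt),
      (∀ p ∈ coprimePairs H, 1 ≤ n p ∧ (n p : ℝ) ≤ K * H ^ 6 ∧
        0 < n p ^ 3 + a₂ * n p ^ 2 + a₁ * n p + a₀ ∧
        ν p * star (ν p) = ((n p ^ 3 + a₂ * n p ^ 2 + a₁ * n p + a₀ : ℤ) : GaussianInt)) ∧
      ∀ p ∈ coprimePairs H, ∀ q ∈ coprimePairs H, n p = n q → ν p ∣ ν q → p = q := by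
  obtain ⟨K, hK, H₁, h₁⟩ := exists_isControlledFactor hA hB (1 + |a₂| + |a₁| + |a₀|)
  obtain ⟨H₂, h₂⟩ := CubicMul.exists_coeff_eq_zero a₂ a₁ a₀ hK hK
  refine ⟨K, hK, max H₁ ⌈H₂⌉₊, fun H hH ↦ ?_⟩
  have hH₂ : H₂ ≤ H := Nat.ceil_le.1 ((le_max_right _ _).trans hH)
  have h₃ := h₁ H ((le_max_left _ _).trans hH)
  choose! n x y hN hF using h₃
  set z : (Σ _ : ℕ, ℕ) → GaussianInt := fun p ↦ ⟨2 * p.1, p.2⟩ with hz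
  have hpos : ∀ p ∈ coprimePairs H, 0 < n p ^ 3 + a₂ * n p ^ 2 + a₁ * n p + a₀ :=
    fun p hp ↦ cubic_pos (hN p hp)
  refine ⟨n, fun p ↦ cubicNorm (a₂ : GaussianInt) a₁ a₀ (x p) (y p) (z p), ?_, ?_⟩
  · intro p hp
    have := hN p hp
    refine ⟨by linarith [abs_nonneg a₂, abs_nonneg a₁, abs_nonneg a₀], (hF p hp).le_pow,
      hpos p hp, ?_⟩
    have := (hF p hp).cubicMul.cubicNorm_mul
    rw [cubicNorm_conj, cubicNorm_sub_root] at this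
    rw [this]
    push_cast
    ring
  · intro p hp q hq hnpq hd
    have hn0 : (n p : GaussianInt) ^ 3 + a₂ * (n p : GaussianInt) ^ 2 + a₁ * (n p : GaussianInt)
        + a₀ ≠ 0 := by
      exact_mod_cast (hpos p hp).ne'
    have Fp := hF p hp
    have Fq := hF q hq
    rw [← hnpq] at Fq
    obtain ⟨η₀, η₁, η₂, hη⟩ := Fp.cubicMul.exists_cubicMul_of_norm_dvd Fq.cubicMul hn0 hd
    obtain ⟨hY, hZ⟩ := h₂ H hH₂ _ _ _ _ _ _ _ _ _ hη Fp.le_norm Fp.norm_snd_le Fp.norm_trd_le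
      Fq.norm_le Fq.norm_snd_le Fq.norm_trd_le
    have wedge : ∀ p ∈ coprimePairs H, (0 : ℤ) < p.2 ∧ (p.2 : ℤ) < 2 * p.1 := by
      rintro ⟨u, t⟩ hp
      simp only [coprimePairs, Finset.mem_sigma, Finset.mem_Ico, Finset.mem_filter,
        Finset.mem_range] at hp
      obtain ⟨-, htu, hcop⟩ := hp
      refine ⟨?_, by exact_mod_cast htu⟩
      rcases Nat.eq_zero_or_pos t with rfl | h
      · rw [Nat.coprime_zero_right] at hcop; omega
      · exact_mod_cast h
    obtain ⟨e₁, e₂⟩ := eq_of_eq_mul_of_wedge hY hZ Fp.det Fq.det (wedge p hp).1 (wedge p hp).2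
      (wedge q hq).1 (wedge q hq).2
    obtain ⟨u, t⟩ := p
    obtain ⟨u', t'⟩ := q
    simp only at e₁ e₂
    have f₁ : u = u' := by omega
    have f₂ : t = t' := by omega
    rw [f₁, f₂]

/-! ### Counting pairs and bounding fibres. -/

theorem card_coprimePairs (H : ℕ) :
    (coprimePairs H).card = ∑ u ∈ Finset.Ico H (2 * H), (2 * u).totient := by
  simp [coprimePairs, Finset.card_sigma, Nat.totient]

theorem exists_mul_rpow_le_card_coprimePairs {ε : ℝ} (hε : 0 < ε) :
    ∃ c : ℝ, 0 < c ∧ ∀ H : ℕ, 0 < H → c * (H : ℝ) ^ (2 - ε) ≤ ((coprimePairs H).card : ℝ) := by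
  obtain ⟨C, hC, h⟩ := Nat.exists_card_divisors_le_mul_rpow hε
  refine ⟨2 / (C * 4 ^ ε), by positivity, fun H hH ↦ ?_⟩
  have hH' : (0 : ℝ) < H := by exact_mod_cast hH
  have key : ∀ u ∈ Finset.Ico H (2 * H),
      2 / (C * 4 ^ ε) * (H : ℝ) ^ (1 - ε) ≤ ((2 * u).totient : ℝ) := by
    intro u hu
    obtain ⟨h₁, h₂⟩ := Finset.mem_Ico.1 hu
    have hu0 : 2 * u ≠ 0 := by omega
    have e₁ : (H : ℝ) ≤ u := by exact_mod_cast h₁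
    have e₂ : (u : ℝ) ≤ 2 * H := by exact_mod_cast h₂.le
    have b₁ : ((2 * u : ℕ) : ℝ) ≤ (2 * u).divisors.card * (2 * u).totient := by
      exact_mod_cast Nat.le_card_divisors_mul_totient hu0
    have b₂ : (((2 * u).divisors.card : ℕ) : ℝ) ≤ C * 4 ^ ε * (H : ℝ) ^ ε := by
      refine (h _ hu0).trans ?_
      rw [mul_assoc, ← Real.mul_rpow (by norm_num) hH'.le]
      gcongr
      push_cast
      linarith
    rw [Real.rpow_sub hH', Real.rpow_one, div_mul_div_comm, div_le_iff₀ (by positivity)]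
    calc 2 * (H : ℝ) ≤ ((2 * u : ℕ) : ℝ) := by push_cast; linarith
      _ ≤ (2 * u).divisors.card * (2 * u).totient := b₁
      _ ≤ C * 4 ^ ε * (H : ℝ) ^ ε * (2 * u).totient := by gcongr
      _ = _ := by ring
  rw [card_coprimePairs]
  push_cast
  have := Finset.card_nsmul_le_sum _ _ _ key
  rw [Nat.card_Ico, nsmul_eq_mul, show 2 * H - H = H by omega] at this
  refine le_trans (le_of_eq ?_) this
  rw [show (2 : ℝ) - ε = 1 + (1 - ε) by ring, Real.rpow_add hH', Real.rpow_one]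
  ring

theorem finite_sumTwoSquaresValues (p : Polynomial ℤ) (X : ℝ) :
    (sumTwoSquaresValues p X).Finite :=
  (Set.finite_Icc 1 ⌊X⌋).subset fun _ hn ↦ ⟨hn.1, Int.le_floor.2 hn.2.1⟩

theorem eval_monicCubic (a₂ a₁ a₀ n : ℤ) :
    (monicCubic a₂ a₁ a₀).eval n = n ^ 3 + a₂ * n ^ 2 + a₁ * n + a₀ := by
  simp [monicCubic]

theorem cubic_le {a₂ a₁ a₀ n : ℤ} (hn : 1 ≤ n) :
    n ^ 3 + a₂ * n ^ 2 + a₁ * n + a₀ ≤ (1 + |a₂| + |a₁| + |a₀|) * n ^ 3 := by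
  have h1 : n ^ 2 ≤ n ^ 3 := pow_le_pow_right₀ hn (by norm_num)
  have h2 : n ≤ n ^ 3 := le_self_pow₀ hn (by norm_num)
  have h3 : 1 ≤ n ^ 3 := one_le_pow₀ hn
  have b₂ : a₂ * n ^ 2 ≤ |a₂| * n ^ 3 := by
    gcongr; exact le_abs_self a₂
  have b₁ : a₁ * n ≤ |a₁| * n ^ 3 := by
    gcongr; exact le_abs_self a₁
  have b₀ : a₀ ≤ |a₀| * n ^ 3 := (le_abs_self a₀).trans (le_mul_of_one_le_right (abs_nonneg _) h3)
  linarith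

open UniqueFactorizationMonoid in
/-- If elements of `s` are determined by `ν` up to divisibility among those with equal `n`, and
`ν p` divides the nonzero Gaussian integer `P (n p)`, then the fibres of `n` are at most as numerous
as divisors of `P (n p)`. -/
theorem card_fibre_le {α : Type*} [DecidableEq α] {s : Finset α} {n : α → ℤ} {ν : α → GaussianInt}
    (hinj : ∀ p ∈ s, ∀ q ∈ s, n p = n q → ν p ∣ ν q → p = q) {m : ℤ} {P : GaussianInt} (hP : P ≠ 0)
    (hd : ∀ p ∈ s, n p = m → ν p ∣ P) :
    (s.filter fun p ↦ n p = m).card ≤ (Finset.Iic (normalizedFactors P)).card := by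
  refine Finset.card_le_card_of_injOn (fun p ↦ normalizedFactors (ν p)) ?_ ?_
  · intro p hp
    obtain ⟨hp, hpm⟩ := Finset.mem_filter.1 hp
    have h := hd p hp hpm
    simpa using (dvd_iff_normalizedFactors_le_normalizedFactors (ne_zero_of_dvd_ne_zero hP h) hP).1 h
  · intro p hp q hq hpq
    obtain ⟨hp, hpm⟩ := Finset.mem_filter.1 hp
    obtain ⟨hq, hqm⟩ := Finset.mem_filter.1 hq
    refine hinj p hp q hq (hpm.trans hqm.symm) ?_
    exact ((associated_iff_normalizedFactors_eq_normalizedFactors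
      (ne_zero_of_dvd_ne_zero hP (hd p hp hpm)) (ne_zero_of_dvd_ne_zero hP (hd q hq hqm))).2 hpq).dvd

/-- The number of distinct `n` is at least the number of pairs divided by the largest fibre. Each of
these two counts loses `H^(ε/2)`. -/
theorem exists_mul_rpow_le_ncard {a₂ a₁ a₀ : ℤ} (hA : Even (a₂ ^ 2 - a₁))
    (hB : Odd (a₁ * a₂ - a₀)) : ∃ K : ℝ, 0 ≤ K ∧ ∀ ε : ℝ, 0 < ε → ∃ c : ℝ, 0 < c ∧ ∃ H₀ : ℕ,
      ∀ H ≥ H₀, c * (H : ℝ) ^ (2 - ε) ≤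
        ((sumTwoSquaresValues (monicCubic a₂ a₁ a₀) (K * H ^ 6)).ncard : ℝ) := by
  obtain ⟨K, hK, H₁, h₁⟩ := exists_norm_family hA hB
  refine ⟨K, hK, fun ε hε ↦ ?_⟩
  obtain ⟨c, hc, h₂⟩ := exists_mul_rpow_le_card_coprimePairs (half_pos hε)
  -- The Gaussian norm of `p(n)` is `p(n)² ≪ H³⁶`, so the exponent `ε/72` costs exactly `H^(ε/2)`.
  obtain ⟨C, hC, h₃⟩ := GaussianInt.exists_card_Iic_normalizedFactors_le_mul_rpow
    (show 0 < ε / 72 by positivity)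
  set L : ℝ := ((1 + |a₂| + |a₁| + |a₀| : ℤ) : ℝ) with hL
  have hL0 : 1 ≤ L := by
    rw [hL]
    exact_mod_cast (by linarith [abs_nonneg a₂, abs_nonneg a₁, abs_nonneg a₀] :
      1 ≤ 1 + |a₂| + |a₁| + |a₀|)
  set D : ℝ := C * ((L * K ^ 3) ^ 2 + 1) ^ (ε / 72) with hD
  have hD0 : 0 < D := by positivity
  refine ⟨c / D, by positivity, max H₁ 1, fun H hH ↦ ?_⟩
  have hH1 : 0 < H := (le_max_right _ _).trans hH
  have hH0 : (0 : ℝ) < H := by exact_mod_cast hH1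
  obtain ⟨n, ν, hn, hinj⟩ := h₁ H ((le_max_left _ _).trans hH)
  set s := coprimePairs H
  have fibre : ∀ m ∈ s.image n,
      (s.filter fun p ↦ n p = m).card ≤ ⌊D * (H : ℝ) ^ (ε / 2)⌋₊ := by
    intro m hm
    obtain ⟨p, hp, rfl⟩ := Finset.mem_image.1 hm
    obtain ⟨b₁, b₂, b₃, -⟩ := hn p hp
    set P : ℤ := n p ^ 3 + a₂ * n p ^ 2 + a₁ * n p + a₀ with hP
    have hP0 : (P : GaussianInt) ≠ 0 := by exact_mod_cast b₃.ne'
    refine Nat.le_floor ?_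
    have f₁ := card_fibre_le hinj (m := n p) hP0 fun q hq hqp ↦ by
      obtain ⟨-, -, -, h⟩ := hn q hq
      rw [hqp] at h
      exact Dvd.intro _ h
    have hPle : (P : ℝ) ≤ L * K ^ 3 * H ^ 18 := by
      calc (P : ℝ) ≤ L * (n p : ℝ) ^ 3 := by rw [hL]; exact_mod_cast cubic_le b₁
        _ ≤ L * (K * H ^ 6) ^ 3 := by
          have : (0 : ℝ) ≤ n p := by exact_mod_cast (by linarith : 0 ≤ n p)
          gcongr
        _ = _ := by ring
    have hP0' : (0 : ℝ) ≤ P := by exact_mod_cast b₃.le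
    calc (((s.filter fun q ↦ n q = n p).card : ℕ) : ℝ)
        ≤ C * (((P : GaussianInt).norm : ℤ) : ℝ) ^ (ε / 72) :=
          (Nat.cast_le.2 f₁).trans (h₃ _ hP0)
      _ = C * ((P : ℝ) ^ 2) ^ (ε / 72) := by
          rw [Zsqrtd.norm_intCast]; push_cast; rw [pow_two]
      _ ≤ C * (((L * K ^ 3) ^ 2 + 1) * (H : ℝ) ^ (36 : ℝ)) ^ (ε / 72) := by
          gcongr
          calc (P : ℝ) ^ 2 ≤ (L * K ^ 3 * H ^ 18) ^ 2 := by gcongr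
            _ = (L * K ^ 3) ^ 2 * H ^ 36 := by ring
            _ ≤ _ := by
              rw [show (36 : ℝ) = (36 : ℕ) by norm_num, Real.rpow_natCast]
              gcongr
              linarith
      _ = D * (H : ℝ) ^ (ε / 2) := by
          rw [Real.mul_rpow (by positivity) (by positivity), ← Real.rpow_mul hH0.le, hD,
            show 36 * (ε / 72) = ε / 2 by ring]
          ring
  have hcard := Finset.card_le_mul_card_image s _ fibre
  have hsub : ((s.image n).card : ℕ) ≤
      (sumTwoSquaresValues (monicCubic a₂ a₁ a₀) (K * H ^ 6)).ncard := by
    rw [← Set.ncard_coe_finset]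
    refine Set.ncard_le_ncard ?_ (finite_sumTwoSquaresValues _ _)
    intro m hm
    obtain ⟨p, hp, rfl⟩ := Finset.mem_image.1 (Finset.mem_coe.1 hm)
    obtain ⟨b₁, b₂, -, b₄⟩ := hn p hp
    refine ⟨b₁, b₂, (ν p).re, (ν p).im, ?_⟩
    rw [eval_monicCubic]
    have := congrArg Zsqrtd.re b₄
    simp only [Zsqrtd.re_mul, Zsqrtd.re_star, Zsqrtd.im_star, Zsqrtd.re_intCast] at this
    linarith
  have hfin : c * (H : ℝ) ^ (2 - ε / 2) ≤ D * (H : ℝ) ^ (ε / 2)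
      * (sumTwoSquaresValues (monicCubic a₂ a₁ a₀) (K * H ^ 6)).ncard := by
    calc c * (H : ℝ) ^ (2 - ε / 2) ≤ (s.card : ℝ) := h₂ H hH1
      _ ≤ ((⌊D * (H : ℝ) ^ (ε / 2)⌋₊ * (s.image n).card : ℕ) : ℝ) := Nat.cast_le.2 hcard
      _ ≤ _ := by
        push_cast
        gcongr
        exact Nat.floor_le (by positivity)
  have hHe : (0 : ℝ) < (H : ℝ) ^ (ε / 2) := by positivity
  rw [show 2 - ε / 2 = (2 - ε) + ε / 2 by ring, Real.rpow_add hH0, ← mul_assoc] at hfin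
  rw [div_mul_eq_mul_div, div_le_iff₀ hD0]
  nlinarith

/-! ### From `ε`-bounds at sixth powers to the `o(1)` form. -/

theorem lowerBoundPowSubLittleO_of_forall_rpow_le {f : ℝ → ℝ} {a : ℝ}
    (h : ∀ ε : ℝ, 0 < ε → ∀ᶠ X in Filter.atTop, X ^ (a - ε) ≤ f X) :
    LowerBoundPowSubLittleO f a := by
  -- This `δ` is the actual deficit of the exponent `log f / log X` below `a`. It is truncated at
  -- `0` because `f` may exceed `X^a`.
  refine ⟨fun X ↦ max 0 (a - Real.log (f X) / Real.log X), ?_, 1, one_pos, ?_⟩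
  · rw [Metric.tendsto_nhds]
    intro ε hε
    filter_upwards [h _ (half_pos hε), Filter.eventually_gt_atTop 1] with X hX hX1
    have hlog : 0 < Real.log X := Real.log_pos hX1
    have h1 : (a - ε / 2) * Real.log X ≤ Real.log (f X) := by
      rw [← Real.log_rpow (by linarith)]
      exact Real.log_le_log (by positivity) hX
    rw [← le_div_iff₀ hlog] at h1
    rw [Real.dist_0_eq_abs, abs_of_nonneg (le_max_left _ _)]
    exact max_lt hε (by linarith)
  · filter_upwards [h 1 one_pos, Filter.eventually_gt_atTop 1] with X hX hX1
    have hlog : 0 < Real.log X := Real.log_pos hX1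
    have hf : 0 < f X := lt_of_lt_of_le (by positivity) hX
    calc 1 * X ^ (a - max 0 (a - Real.log (f X) / Real.log X))
        ≤ X ^ (Real.log (f X) / Real.log X) := by
          rw [one_mul]
          refine Real.rpow_le_rpow_of_exponent_le hX1.le ?_
          linarith [le_max_right 0 (a - Real.log (f X) / Real.log X)]
      _ = f X := by
          rw [Real.rpow_def_of_pos (by linarith), mul_div_cancel₀ _ hlog.ne', Real.exp_log hf]

/-- Passing from the values `K H⁶` to all real arguments. -/
theorem eventually_rpow_le_of_sixth_powers {f : ℝ → ℝ} (hf : Monotone f) {K : ℝ} (hK : 0 ≤ K)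
    (h : ∀ ε : ℝ, 0 < ε → ∃ c : ℝ, 0 < c ∧ ∃ H₀ : ℕ, ∀ H ≥ H₀,
      c * (H : ℝ) ^ (2 - ε) ≤ f (K * H ^ 6)) {ε : ℝ} (hε : 0 < ε) :
    ∀ᶠ X in Filter.atTop, X ^ (1 / 3 - ε) ≤ f X := by
  -- This keeps `2 - ε` nonnegative, so that `Y/2 ≤ H` can be raised to that power.
  wlog hε1 : ε ≤ 1 generalizing ε
  · filter_upwards [this one_pos le_rfl, Filter.eventually_ge_atTop 1] with X hX hX1
    refine le_trans (Real.rpow_le_rpow_of_exponent_le hX1 ?_) hX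
    linarith
  obtain ⟨c, hc, H₀, h₀⟩ := h ε hε
  -- Dividing by `K + 1` rather than `K` covers `K = 0`.
  set Y : ℝ → ℝ := fun X ↦ (X / (K + 1)) ^ (1 / 6 : ℝ) with hY
  have hK1 : 0 < K + 1 := by linarith
  have hYt : Filter.Tendsto Y Filter.atTop Filter.atTop :=
    (tendsto_rpow_atTop (by norm_num)).comp (Filter.tendsto_id.atTop_div_const hK1)
  have hpow : Filter.Tendsto (fun X : ℝ ↦ X ^ (5 / 6 * ε)) Filter.atTop Filter.atTop :=
    tendsto_rpow_atTop (by positivity)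
  set b : ℝ := c * (1 / 2) ^ (2 - ε) * ((K + 1) ^ ((2 - ε) / 6))⁻¹ with hb
  have hb0 : 0 < b := by positivity
  filter_upwards [hYt.eventually_ge_atTop (H₀ + 2), hpow.eventually_ge_atTop b⁻¹,
    Filter.eventually_gt_atTop 0] with X hX1 hX2 hX0
  set H := ⌊Y X⌋₊ with hH
  have hY0 : 0 ≤ Y X := by positivity
  have hle : (H : ℝ) ≤ Y X := Nat.floor_le hY0
  have hlt : Y X < H + 1 := Nat.lt_floor_add_one _
  have hH₀ : H₀ ≤ H := Nat.le_floor (by linarith)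
  have hhalf : 1 / 2 * Y X ≤ H := by
    have : (0 : ℝ) ≤ H₀ := by positivity
    linarith
  have hY6 : Y X ^ 6 = X / (K + 1) := by
    rw [hY, ← Real.rpow_natCast, ← Real.rpow_mul (by positivity)]
    norm_num
  have hKH : K * (H : ℝ) ^ 6 ≤ X := by
    calc K * (H : ℝ) ^ 6 ≤ (K + 1) * Y X ^ 6 := by gcongr; linarith
      _ = X := by rw [hY6]; field_simp
  refine le_trans ?_ ((h₀ H hH₀).trans (hf hKH))
  -- The exponent obtained is `(2 - ε)/6 = 1/3 - ε/6`. The surplus `X^(5ε/6)` over the target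
  -- absorbs the constant `b`.
  calc X ^ (1 / 3 - ε) ≤ b * X ^ (5 / 6 * ε) * X ^ (1 / 3 - ε) := by
        refine le_mul_of_one_le_left (by positivity) ?_
        rwa [inv_le_iff_one_le_mul₀' hb0] at hX2
    _ = b * X ^ ((2 - ε) / 6) := by
        rw [mul_assoc, ← Real.rpow_add hX0]; ring_nf
    _ = c * (1 / 2 * Y X) ^ (2 - ε) := by
        rw [Real.mul_rpow (by norm_num) hY0, hY, ← Real.rpow_mul (by positivity),
          Real.div_rpow hX0.le hK1.le, hb, show 1 / 6 * (2 - ε) = (2 - ε) / 6 by ring]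
        ring
    _ ≤ c * (H : ℝ) ^ (2 - ε) := by
        have : 0 ≤ 2 - ε := by linarith
        gcongr

theorem monotone_ncard_sumTwoSquaresValues (p : Polynomial ℤ) :
    Monotone fun X : ℝ ↦ ((sumTwoSquaresValues p X).ncard : ℝ) := fun _ Y hXY ↦
  Nat.cast_le.2 <| Set.ncard_le_ncard (fun _ hn ↦ ⟨hn.1, hn.2.1.trans hXY, hn.2.2⟩)
    (finite_sumTwoSquaresValues p Y)

theorem lowerBound_monicCubic {a₂ a₁ a₀ : ℤ} (hA : Even (a₂ ^ 2 - a₁))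
    (hB : Odd (a₁ * a₂ - a₀)) : LowerBoundPowSubLittleO
      (fun X : ℝ ↦ ((sumTwoSquaresValues (monicCubic a₂ a₁ a₀) X).ncard : ℝ)) (1 / 3) := by
  obtain ⟨K, hK, h⟩ := exists_mul_rpow_le_ncard hA hB
  exact lowerBoundPowSubLittleO_of_forall_rpow_le fun ε hε ↦
    eventually_rpow_le_of_sixth_powers (monotone_ncard_sumTwoSquaresValues _) hK h hε

theorem theorem1p1 :
    (∀ a₂ a₁ a₀ : ℤ,
      Irreducible (Polynomial.X ^ 3 + Polynomial.C a₂ * Polynomial.X ^ 2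
        + Polynomial.C a₁ * Polynomial.X + Polynomial.C a₀ : Polynomial ℤ) →
      Even (a₂ ^ 2 - a₁) →
      Odd (a₁ * a₂ - a₀) →
      LowerBoundPowSubLittleO
        (fun X : ℝ => ((sumTwoSquaresValues
          (Polynomial.X ^ 3 + Polynomial.C a₂ * Polynomial.X ^ 2
            + Polynomial.C a₁ * Polynomial.X + Polynomial.C a₀) X).ncard : ℝ))
        (1 / 3)) ∧
    (∀ h : ℤ, Odd h → (¬ ∃ m : ℤ, h = m ^ 3) →
      LowerBoundPowSubLittleO
        (fun X : ℝ => ((sumTwoSquaresValues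
          (Polynomial.X ^ 3 + Polynomial.C h) X).ncard : ℝ))
        (1 / 3)) := by
  refine ⟨fun a₂ a₁ a₀ _ hA hB ↦ lowerBound_monicCubic hA hB, fun h hh _ ↦ ?_⟩
  have := lowerBound_monicCubic (a₂ := 0) (a₁ := 0) (a₀ := h) (by simp) (by simpa using hh)
  simpa [monicCubic] using this
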